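/- **Theorem.** Let $S$ be a finite state space, $A(s)$ ($s\in S$) finite action sets, $\mathcal K=\{(s,a): s\in S, a\in A(s)\}$, $p(s,a,\cdot)$ transition probabilities on $S$, $\gamma$ a probability distribution on $S$, $\alpha\in(0,1)$, and $$\mathcal Q_\alpha(\gamma)=\Big\{\rho\in\mathbb R^{|\mathcal K|} : \sum_{(s,a)\in\mathcal K}\rho(s,a)\big(\delta(s',s)-\alpha p(s,a,s')\big)=(1-\alpha)\gamma(s')\ \ \forall s'\in S,\ \ \rho\ge 0\Big\},$$ where $\delta$ is the Kronecker delta. Let $\varphi=\mathbb R_+^{|\mathcal K|}$ with the Euclidean distance, $H\ge1$, $\tilde\xi_1,\dots,\tilde\xi_H\in\varphi$, $\nu=\frac1H\sum_{i=1}^H\delta_{\tilde\xi_i}$, $\epsilon\in(0,1)$ and $\theta_W>0$. Let $\mathcal D$ be the set of Borel probability measures $F$ on $\varphi$ with finite first moment and $W_1(F,\nu)\le\theta_W$, where $W_1(F,\nu)=\inf_\pi\int_{\varphi\times\varphi}\|x-z\|_2\,\pi(dx,dz)$ over all couplings $\pi$ of $F$ and $\nu$. Consider the distributionally robust chance-constrained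 MDP $$\text{(P)}\qquad \sup\ y\quad\text{s.t.}\quad \sup_{F\in\mathcal D}F\big(\{r\in\varphi:\rho^{T}r\le y\}\big)\le\epsilon,\quad \rho\in\mathcal Q_\alpha(\gamma),$$ in the variables $(y,\rho)\in\mathbb R\times\mathbb R^{|\mathcal K|}$, and the problem, in the variables $(y,\rho,l,(g_i),(\lambda_i),(\zeta_i))$, $$\text{(B)}\qquad\begin{aligned}\sup\ y\quad\text{s.t.}\quad &\theta_W-\tfrac1H\textstyle\sum_{i=1}^H g_i\le l\epsilon,\\ &\lambda_i(\rho^T\tilde\xi_i-y)-\zeta_i^T\tilde\xi_i\ge l+g_i,\quad \|\zeta_i-\lambda_i\rho\|_2\le1,\quad i=1,\dots,H,\\ &\lambda_i\ge0,\ \zeta_i\in\mathbb R_+^{|\mathcal K|},\ g_i\le0,\quad i=1,\dots,H,\qquad l>0,\ \rho\in\mathcal Q_\alpha(\gamma).\end{aligned}$$ Then (P) and (B) are equivalent: a pair $(y,\rho)$ is feasible for (P) if and only if there are $l,(g_i),(\lambda_i),(\zeta_i)$ such that $(y,\rho,l,(g_i),(\lambda_i),(\zeta_i))$ is feasible for (B).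 Consequently the two problems have the same optimal value in $[-\infty,\infty]$, and the optimal $(y,\rho)$ of (P), if any, are exactly the $(y,\rho)$-parts of the optimal solutions of (B). Moreover (B) is biconvex: for fixed $(y,\rho)$ its feasible set is convex in $(l,(g_i),(\lambda_i),(\zeta_i))$, for fixed $(l,(g_i),(\lambda_i),(\zeta_i))$ it is convex in $(y,\rho)$, and the objective is linear. -/

import Mathlib

open MeasureTheory
open scoped ENNReal

noncomputable section

/-! ### Wasserstein ambiguity sets on a metric space -/

/-- Borel probability measures on `X` with finite `p`-th moment. -/
def finiteMomentMeasures (X : Type*) [MetricSpace X] [MeasurableSpace X] (p : ℝ) :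
    Set (Measure X) :=
  {μ | IsProbabilityMeasure μ ∧ ∃ x₀ : X, ∫⁻ x, edist x x₀ ^ p ∂μ < ∞}

/-- Probability measures on `X × X` with marginals `μ` and `ν`. -/
def couplings {X : Type*} [MeasurableSpace X] (μ ν : Measure X) : Set (Measure (X × X)) :=
  {π | IsProbabilityMeasure π ∧ π.map Prod.fst = μ ∧ π.map Prod.snd = ν}

/-- The `p`-Wasserstein distance (with values in `[0, ∞]`). -/
def wassersteinDist {X : Type*} [MetricSpace X] [MeasurableSpace X] (p : ℝ)
    (μ ν : Measure X) : ℝ≥0∞ :=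
  (⨅ π ∈ couplings μ ν, ∫⁻ w, edist w.1 w.2 ^ p ∂π) ^ (1 / p)

/-- The closed `p`-Wasserstein ball of radius `θ` around `ν`. -/
def wassersteinBall {X : Type*} [MetricSpace X] [MeasurableSpace X] (ν : Measure X)
    (p θ : ℝ) : Set (Measure X) :=
  {F | F ∈ finiteMomentMeasures X p ∧ wassersteinDist p F ν ≤ ENNReal.ofReal θ}

/-- The empirical distribution `(1 / H) ∑ i, δ_{ξ i}` of `H` scenarios. -/
def empiricalMeasure {X : Type*} [MeasurableSpace X] {H : ℕ} (ξ : Fin H → X) : Measure X :=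
  (H : ℝ≥0∞)⁻¹ • ∑ i, Measure.dirac (ξ i)

/-! ### The decision problem -/

/-- The nonnegative orthant of Euclidean space. -/
def nonnegOrthant (K : Type*) : Set (EuclideanSpace ℝ K) :=
  {z | ∀ k, 0 ≤ z k}

/-- The polytope of discounted occupation measures of the MDP with finite state space `S`, action
sets `A s`, transition probabilities `p (s, a) s'`, initial distribution `γ` and discount
factor `α`. -/
def occupationPolytope {S : Type*} {A : S → Type*} [Fintype S] [DecidableEq S]
    [∀ s, Fintype (A s)] (p : (Σ s, A s) → S → ℝ) (γ : S → ℝ) (α : ℝ) :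
    Set (EuclideanSpace ℝ (Σ s, A s)) :=
  {ρ | (∀ s' : S, ∑ k, ρ k * ((if s' = k.1 then 1 else 0) - α * p k s') = (1 - α) * γ s') ∧
    ∀ k, 0 ≤ ρ k}

/-- The feasible set of the distributionally robust chance-constrained problem
`sup y` s.t. `sup_{F ∈ D} P_F (ρᵀ R ≤ y) ≤ ε` and `ρ ∈ Q`, where `D` is a set of distributions of
the reward vector `R` on the support `φ`. -/
def drccFeasible {K : Type*} [Fintype K] (φ : Set (EuclideanSpace ℝ K)) (D : Set (Measure φ))
    (Q : Set (EuclideanSpace ℝ K)) (ε : ℝ) : Set (ℝ × EuclideanSpace ℝ K) :=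
  {x | (⨆ F ∈ D, F {r : φ | inner ℝ x.2 (r : EuclideanSpace ℝ K) ≤ x.1}) ≤ ENNReal.ofReal ε ∧
    x.2 ∈ Q}

/-- The feasible set of the deterministic reformulation, in the variables
`((y, ρ), (l, g, lam, ζ))`. -/
def biconvexFeasible {K : Type*} [Fintype K] {H : ℕ} (ξ : Fin H → EuclideanSpace ℝ K)
    (Q : Set (EuclideanSpace ℝ K)) (ε θ : ℝ) :
    Set ((ℝ × EuclideanSpace ℝ K) ×
      (ℝ × (Fin H → ℝ) × (Fin H → ℝ) × (Fin H → EuclideanSpace ℝ K))) :=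
  {w | match w with
    | ((y, ρ), (l, g, lam, ζ)) =>
      θ - (1 / (H : ℝ)) * ∑ i, g i ≤ l * ε ∧
      (∀ i, lam i * (inner ℝ ρ (ξ i) - y) - inner ℝ (ζ i) (ξ i) ≥ l + g i) ∧
      (∀ i, ‖ζ i - lam i • ρ‖ ≤ 1) ∧
      (∀ i, 0 ≤ lam i) ∧ (∀ i, ζ i ∈ nonnegOrthant K) ∧ 0 < l ∧ (∀ i, g i ≤ 0) ∧ ρ ∈ Q}

/-! ### Optimization vocabulary -/

/-- The supremum of `f` over `B`, in the extended reals (`⊥` if `B` is empty). -/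
def optimalValue {X : Type*} (B : Set X) (f : X → ℝ) : EReal :=
  ⨆ x ∈ B, (f x : EReal)

/-- The set of maximizers of `f` over `B`. -/
def optimalSolutions {X : Type*} (B : Set X) (f : X → ℝ) : Set X :=
  {x | x ∈ B ∧ ∀ x' ∈ B, f x' ≤ f x}

/-- Maximizing `f` over `B` is a biconvex program with respect to the splitting `X × Y` of the
variables: with either block fixed, the feasible set is convex and the objective is concave. -/
def IsBiconvexProgram {X Y : Type*} [AddCommGroup X] [Module ℝ X] [AddCommGroup Y] [Module ℝ Y]
    (B : Set (X × Y)) (f : X × Y → ℝ) : Prop :=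
  (∀ x, ConcaveOn ℝ {y | (x, y) ∈ B} fun y => f (x, y)) ∧
  (∀ y, ConcaveOn ℝ {x | (x, y) ∈ B} fun x => f (x, y))

end

/-!
For `(y, ρ)` with `ρ ≥ 0`, let `U = {r ≥ 0 | ρᵀ r ≤ y}` be the unsafe set and `d i` the distance
from the scenario `ξ i` to `U`. Two finite-dimensional dualities turn the robust chance constraint
into the constraints of the reformulation.

* *Worst-case probability.* The robust constraint holds iff
  `θ + (1 / H) ∑ i, (l - d i)⁺ ≤ l ε` for some `l > 0`; the variable `g i` stands for `-(l - d i)⁺`.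
  Sufficiency integrates the pointwise bound `l 1_U(r) ≤ ‖r - x‖ + (l - d(x, U))⁺` against couplings
  (`measure_le_of_mem_wassersteinBall`), so no measurable selection or minimax theorem enters.
  For necessity, if every `l` fails, the greedy solution of a fractional knapsack problem
  (`exists_fractional_selection`) says which fraction of each atom to move to its projection on `U`:
  the resulting distribution (`partialTransport`) lies in the Wasserstein ball and gives `U` a
  probability larger than `ε`.
* *Distance.* `d i` is the maximum of `λ (ρᵀ ξ - y) - ζᵀ ξ` over `λ, ζ ≥ 0` with `‖ζ - λ ρ‖ ≤ 1`.
  Weak duality is Cauchy-Schwarz (`dual_value_le_norm_sub`). Attainment for `y ≥ 0` follows from the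
  explicit projection `(ξ - t ρ)⁺` (`exists_projection_dual_value_eq`). For `y < 0` the set `U` is
  empty and the dual is unbounded, which agrees with the robust constraint being vacuous.

Hence the feasible set of the robust problem is the projection of that of the reformulation, and the
statements on optimal values and optimal solutions follow. Biconvexity holds because, with either
block of variables fixed, all constraints are affine inequalities, membership in a convex set, or a
norm bound on an affine map.
-/

/-! ### Distance to the unsafe set in the nonnegative orthant -/

theorem inner_nonneg_of_mem_nonnegOrthant {K : Type*} [Fintype K] {x z : EuclideanSpace ℝ K}
    (hx : x ∈ nonnegOrthant K) (hz : z ∈ nonnegOrthant K) : 0 ≤ inner ℝ x z := by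
  rw [PiLp.inner_apply]
  exact Finset.sum_nonneg fun k _ => mul_nonneg (hz k) (hx k)

/-- Weak duality for the distance from `ξ` to `{r ≥ 0 | ρᵀ r ≤ y}`. -/
theorem dual_value_le_norm_sub {K : Type*} [Fintype K] {ρ ξ ζ r : EuclideanSpace ℝ K} {y c : ℝ}
    (hc : 0 ≤ c) (hζ : ζ ∈ nonnegOrthant K) (hn : ‖ζ - c • ρ‖ ≤ 1)
    (hr : r ∈ nonnegOrthant K) (hry : inner ℝ ρ r ≤ y) :
    c * (inner ℝ ρ ξ - y) - inner ℝ ζ ξ ≤ ‖r - ξ‖ := by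
  have h1 : inner ℝ (ζ - c • ρ) (r - ξ) ≤ ‖r - ξ‖ :=
    (real_inner_le_norm _ _).trans (mul_le_of_le_one_left (norm_nonneg _) hn)
  have h2 := inner_nonneg_of_mem_nonnegOrthant hζ hr
  have h3 := mul_le_mul_of_nonneg_left hry hc
  simp only [inner_sub_left, inner_sub_right, real_inner_smul_left] at h1
  linarith

/-- Strong duality with attainment on both sides. The projection of `ξ` is `(ξ - t ρ)⁺` for a
multiplier `t ≥ 0` found by the intermediate value theorem; no constraint qualification is needed
(so `y = 0` is covered), because `(ξ - t ρ)⁺` is orthogonal to `ρ` for large `t`. -/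
theorem exists_projection_dual_value_eq {K : Type*} [Fintype K] {ρ ξ : EuclideanSpace ℝ K} {y : ℝ}
    (hρ : ρ ∈ nonnegOrthant K) (hξ : ξ ∈ nonnegOrthant K) (hy : 0 ≤ y) :
    ∃ r ∈ nonnegOrthant K, inner ℝ ρ r ≤ y ∧ ∃ c : ℝ, 0 ≤ c ∧ ∃ ζ ∈ nonnegOrthant K,
      ‖ζ - c • ρ‖ ≤ 1 ∧ c * (inner ℝ ρ ξ - y) - inner ℝ ζ ξ = ‖r - ξ‖ := by
  by_cases hle : inner ℝ ρ ξ ≤ y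
  · exact ⟨ξ, hξ, hle, 0, le_rfl, 0, fun k => by simp, by simp, by simp⟩
  push Not at hle
  let f : ℝ → ℝ := fun t => ∑ k, ρ k * max (ξ k - t * ρ k) 0
  have hf : Continuous f := by fun_prop
  have hf0 : f 0 = inner ℝ ρ ξ := by
    simp only [f, PiLp.inner_apply]
    refine Finset.sum_congr rfl fun k _ => ?_
    simp [max_eq_left (hξ k), mul_comm]
  obtain ⟨T, hT0, hT⟩ : ∃ T, 0 ≤ T ∧ f T = 0 := by
    -- `T` dominates every ratio `ξ k / ρ k`; a vanishing `ρ k` contributes nothing to `f`.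
    refine ⟨∑ k, ξ k / ρ k, Finset.sum_nonneg fun k _ => div_nonneg (hξ k) (hρ k), ?_⟩
    refine Finset.sum_eq_zero fun k _ => ?_
    rcases (hρ k).eq_or_lt with h | h
    · simp [← h]
    · have h1 : ξ k / ρ k ≤ ∑ k, ξ k / ρ k :=
        Finset.single_le_sum (f := fun k => ξ k / ρ k)
          (fun k _ => div_nonneg (hξ k) (hρ k)) (Finset.mem_univ k)
      rw [div_le_iff₀ h] at h1
      rw [max_eq_right (by linarith), mul_zero]
  obtain ⟨t, ⟨ht0, -⟩, ht⟩ : y ∈ f '' Set.Icc 0 T :=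
    intermediate_value_Icc' hT0 hf.continuousOn ⟨hT ▸ hy, hf0 ▸ hle.le⟩
  let r : EuclideanSpace ℝ K := WithLp.toLp 2 fun k => max (ξ k - t * ρ k) 0
  let z : EuclideanSpace ℝ K := WithLp.toLp 2 fun k => max (t * ρ k - ξ k) 0
  have hr : r ∈ nonnegOrthant K := fun k => le_max_right _ _
  have hz : z ∈ nonnegOrthant K := fun k => le_max_right _ _
  have hρr : inner ℝ ρ r = y := by
    rw [← ht, PiLp.inner_apply]
    exact Finset.sum_congr rfl fun k _ => mul_comm _ _
  have hzr : inner ℝ z r = 0 := by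
    rw [PiLp.inner_apply]
    refine Finset.sum_eq_zero fun k _ => ?_
    change max (ξ k - t * ρ k) 0 * max (t * ρ k - ξ k) 0 = 0
    rcases le_total (ξ k) (t * ρ k) with h | h
    · rw [max_eq_right (sub_nonpos.2 h), zero_mul]
    · rw [max_eq_right (sub_nonpos.2 h), mul_zero]
  have hsub : r - ξ = z - t • ρ := by
    ext k
    change max (ξ k - t * ρ k) 0 - ξ k = max (t * ρ k - ξ k) 0 - t * ρ k
    rcases le_total (ξ k) (t * ρ k) with h | h
    · rw [max_eq_right (sub_nonpos.2 h), max_eq_left (sub_nonneg.2 h)]; ring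
    · rw [max_eq_right (sub_nonpos.2 h), max_eq_left (sub_nonneg.2 h)]; ring
  have hd : 0 < ‖r - ξ‖ := by
    rw [norm_pos_iff, sub_ne_zero]
    rintro h
    rw [h] at hρr
    exact hle.ne' hρr
  have hval : t * (inner ℝ ρ ξ - y) - inner ℝ z ξ = ‖r - ξ‖ * ‖r - ξ‖ := by
    rw [← real_inner_self_eq_norm_mul_norm]
    nth_rw 1 [hsub]
    simp only [inner_sub_left, inner_sub_right, real_inner_smul_left, hzr, hρr]
    ring
  -- The multipliers `(t, z)` are rescaled so that `z - t ρ` becomes a unit vector.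
  refine ⟨r, hr, hρr.le, ‖r - ξ‖⁻¹ * t, by positivity, ‖r - ξ‖⁻¹ • z, fun k => ?_, ?_, ?_⟩
  · exact mul_nonneg (by positivity) (hz k)
  · rw [mul_smul, ← smul_sub, ← hsub, norm_smul, norm_inv, norm_norm, inv_mul_cancel₀ hd.ne']
  · rw [real_inner_smul_left, mul_assoc, ← mul_sub, hval, inv_mul_cancel_left₀ hd.ne']

/-! ### Fractional knapsack -/

/-- Duality for the fractional knapsack problem: if every threshold `l` fails to certify that at
most `b` units fit into the budget `c`, then some fractional selection within the budget has more
than `b` units. The selection takes all items cheaper than the `b`-quantile of the costs and a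
fraction of those at the quantile. -/
theorem exists_fractional_selection {ι : Type*} [Fintype ι] {d : ι → ℝ} (hd : ∀ i, 0 ≤ d i)
    {b c : ℝ} (hb : 0 ≤ b) (hbι : b < Fintype.card ι)
    (h : ∀ l, 0 ≤ l → l * b < c + ∑ i, max (l - d i) 0) :
    ∃ m : ι → ℝ, (∀ i, 0 ≤ m i) ∧ (∀ i, m i ≤ 1) ∧ ∑ i, m i * d i ≤ c ∧ b < ∑ i, m i := by
  classical
  let T : Finset ι := {i | b < (Finset.card {j | d j ≤ d i} : ℝ)}
  have hT : T.Nonempty := by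
    have : Nonempty ι := Fintype.card_pos_iff.1 (by exact_mod_cast hb.trans_lt hbι)
    obtain ⟨i, -, hi⟩ := Finset.exists_max_image Finset.univ d Finset.univ_nonempty
    refine ⟨i, ?_⟩
    simp only [T, Finset.mem_filter, Finset.mem_univ, true_and]
    rwa [Finset.filter_true_of_mem fun j hj => hi j hj]
  obtain ⟨i₀, hi₀, hmin⟩ := Finset.exists_min_image T d hT
  set l := d i₀ with hl
  let P : Finset ι := {j | d j < l}
  let E : Finset ι := {j | d j = l}
  have hP : (P.card : ℝ) ≤ b := by
    rcases P.eq_empty_or_nonempty with hP | hP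
    · simpa [hP] using hb
    obtain ⟨j, hj, hjm⟩ := Finset.exists_max_image P d hP
    by_contra! hlt
    have hj' : d j < l := by simpa [P] using hj
    refine hj'.not_ge (hmin j ?_)
    simp only [T, Finset.mem_filter, Finset.mem_univ, true_and]
    refine hlt.trans_le ?_
    exact_mod_cast Finset.card_le_card fun k hk => by simpa using hjm k hk
  have hdisj : Disjoint P E := by
    rw [Finset.disjoint_left]
    intro j hj hj'
    simp only [P, E, Finset.mem_filter, Finset.mem_univ, true_and] at hj hj'
    exact hj.ne hj'
  have hPE : b < (P.card : ℝ) + E.card := by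
    have h1 : b < (Finset.card {j | d j ≤ d i₀} : ℝ) := by simpa [T] using hi₀
    have h2 : ({j | d j ≤ d i₀} : Finset ι) = P ∪ E := by
      ext j
      simp [P, E, le_iff_lt_or_eq, hl]
    rw [h2, Finset.card_union_of_disjoint hdisj] at h1
    exact_mod_cast h1
  have hE : 0 < (E.card : ℝ) := by linarith
  have hsum : ∑ i, max (l - d i) 0 = P.card * l - ∑ i ∈ P, d i := by
    have : ∑ i, max (l - d i) 0 = ∑ i ∈ P, (l - d i) := by
      rw [Finset.sum_filter]
      refine Finset.sum_congr rfl fun i _ => ?_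
      split_ifs with hi
      · exact max_eq_left (by linarith)
      · exact max_eq_right (by linarith)
    rw [this, Finset.sum_sub_distrib, Finset.sum_const, nsmul_eq_mul]
  have hτ₀ := h l (hd i₀)
  rw [hsum] at hτ₀
  -- The fraction `(b - |P|) / |E|` selects exactly `b` units strictly within the budget, so a
  -- slightly larger fraction is still within the budget.
  let τ₀ : ℝ := (b - P.card) / E.card
  have hτE : τ₀ * E.card = b - P.card := div_mul_cancel₀ _ hE.ne'
  have hτ1 : τ₀ < 1 := by rw [div_lt_one hE]; linarith
  have hτ0 : 0 ≤ τ₀ := div_nonneg (by linarith) hE.le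
  have hcost : ∑ i ∈ P, d i + τ₀ * (E.card * l) < c := by
    rw [← mul_assoc, hτE]; linarith
  obtain ⟨τ, hτ, hτ1', hτc⟩ : ∃ τ, τ₀ < τ ∧ τ < 1 ∧ ∑ i ∈ P, d i + τ * (E.card * l) < c := by
    have h1 : ∀ᶠ τ in nhds τ₀, ∑ i ∈ P, d i + τ * (E.card * l) < c :=
      Continuous.tendsto (f := fun τ : ℝ => ∑ i ∈ P, d i + τ * (E.card * l)) (by fun_prop) τ₀
        |>.eventually_lt_const hcost
    have h2 := (h1.and (eventually_lt_nhds hτ1)).filter_mono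
      (nhdsWithin_le_nhds (s := Set.Ioi τ₀))
    obtain ⟨τ, h3, h4⟩ := (h2.and self_mem_nhdsWithin).exists
    exact ⟨τ, h4, h3.2, h3.1⟩
  have hτpos : 0 ≤ τ := hτ0.trans hτ.le
  have hsplit : ∀ w : ι → ℝ, ∑ i, (if i ∈ P then 1 else if i ∈ E then τ else 0) * w i =
      ∑ i ∈ P, w i + τ * ∑ i ∈ E, w i := by
    intro w
    rw [Finset.mul_sum, ← Finset.univ_inter P, ← Finset.univ_inter E, ← Finset.sum_ite_mem,
      ← Finset.sum_ite_mem, ← Finset.sum_add_distrib]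
    refine Finset.sum_congr rfl fun i _ => ?_
    by_cases hi : i ∈ P
    · simp [hi, Finset.disjoint_left.1 hdisj hi]
    · simp [hi]
  refine ⟨fun i => if i ∈ P then 1 else if i ∈ E then τ else 0, fun i => ?_, fun i => ?_, ?_, ?_⟩
  · dsimp only; split_ifs <;> linarith
  · dsimp only; split_ifs <;> linarith
  · rw [hsplit]
    have : ∑ i ∈ E, d i = E.card * l := by
      rw [← nsmul_eq_mul, ← Finset.sum_const]
      exact Finset.sum_congr rfl fun i hi => by simpa [E] using hi
    rw [this]; exact hτc.le
  · have := hsplit fun _ => 1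
    simp only [mul_one, Finset.sum_const, nsmul_eq_mul] at this
    rw [this]
    have := mul_lt_mul_of_pos_right hτ hE
    linarith

/-! ### Worst-case probabilities over a Wasserstein ball -/

/-- The distribution that arises from the empirical distribution of `x` by moving, for every `i`,
the fraction `m i` of the atom at `x i` to `r i`. The weights are truncated to `[0, ∞]` by
`ENNReal.ofReal`, so `m` is meant to take values in `[0, 1]`. -/
noncomputable def partialTransport {X : Type*} [MeasurableSpace X] {H : ℕ} (m : Fin H → ℝ)
    (r x : Fin H → X) : Measure X :=
  (H : ℝ≥0∞)⁻¹ • ∑ i, (ENNReal.ofReal (m i) • Measure.dirac (r i) +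
    ENNReal.ofReal (1 - m i) • Measure.dirac (x i))

theorem ofReal_add_ofReal_one_sub {m : ℝ} (h0 : 0 ≤ m) (h1 : m ≤ 1) :
    ENNReal.ofReal m + ENNReal.ofReal (1 - m) = 1 := by
  rw [← ENNReal.ofReal_add h0 (by linarith)]
  simp

theorem partialTransport_self {X : Type*} [MeasurableSpace X] {H : ℕ} {m : Fin H → ℝ}
    (h0 : ∀ i, 0 ≤ m i) (h1 : ∀ i, m i ≤ 1) (x : Fin H → X) :
    partialTransport m x x = empiricalMeasure x := by
  simp only [partialTransport, empiricalMeasure, ← add_smul,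
    ofReal_add_ofReal_one_sub (h0 _) (h1 _), one_smul]

theorem map_partialTransport {X Y : Type*} [MeasurableSpace X] [MeasurableSpace Y] {H : ℕ}
    (m : Fin H → ℝ) (r x : Fin H → X) {f : X → Y} (hf : Measurable f) :
    (partialTransport m r x).map f = partialTransport m (f ∘ r) (f ∘ x) := by
  simp only [partialTransport, Measure.map_smul]
  congr 1
  rw [← Measure.mapₗ_apply_of_measurable hf, map_sum]
  refine Finset.sum_congr rfl fun i _ => ?_
  rw [map_add, map_smul, map_smul, Measure.mapₗ_apply_of_measurable hf,
    Measure.mapₗ_apply_of_measurable hf, Measure.map_dirac' hf, Measure.map_dirac' hf]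
  rfl

theorem lintegral_partialTransport {X : Type*} [MeasurableSpace X] {H : ℕ} (m : Fin H → ℝ)
    (r x : Fin H → X) {f : X → ℝ≥0∞} (hf : Measurable f) :
    ∫⁻ z, f z ∂(partialTransport m r x) =
      (H : ℝ≥0∞)⁻¹ * ∑ i, (ENNReal.ofReal (m i) * f (r i) + ENNReal.ofReal (1 - m i) * f (x i)) := by
  simp only [partialTransport, lintegral_smul_measure, lintegral_finsetSum_measure,
    lintegral_add_measure, lintegral_dirac' _ hf, smul_eq_mul]

theorem isProbabilityMeasure_partialTransport {X : Type*} [MeasurableSpace X] {H : ℕ} (hH : 0 < H)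
    {m : Fin H → ℝ} (h0 : ∀ i, 0 ≤ m i) (h1 : ∀ i, m i ≤ 1) (r x : Fin H → X) :
    IsProbabilityMeasure (partialTransport m r x) := by
  constructor
  rw [← lintegral_one, lintegral_partialTransport m r x measurable_const]
  simp only [mul_one, ofReal_add_ofReal_one_sub (h0 _) (h1 _), Finset.sum_const, Finset.card_univ,
    Fintype.card_fin, nsmul_eq_mul]
  exact ENNReal.inv_mul_cancel (by exact_mod_cast hH.ne') (ENNReal.natCast_ne_top H)

theorem partialTransport_mem_wassersteinBall {X : Type*} [MetricSpace X] [MeasurableSpace X]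
    [BorelSpace X] [SecondCountableTopology X] {H : ℕ} (hH : 0 < H) {m : Fin H → ℝ}
    (h0 : ∀ i, 0 ≤ m i) (h1 : ∀ i, m i ≤ 1) (r x : Fin H → X) {θ : ℝ}
    (hθ : ∑ i, m i * dist (r i) (x i) ≤ H * θ) :
    partialTransport m r x ∈ wassersteinBall (empiricalMeasure x) 1 θ := by
  have hH' : (0 : ℝ) < H := by exact_mod_cast hH
  refine ⟨⟨isProbabilityMeasure_partialTransport hH h0 h1 r x, x ⟨0, hH⟩, ?_⟩, ?_⟩
  · simp only [ENNReal.rpow_one]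
    rw [lintegral_partialTransport _ _ _ (by fun_prop)]
    refine ENNReal.mul_lt_top (by simp [hH]) (ENNReal.sum_lt_top.2 fun i _ => ?_)
    exact ENNReal.add_lt_top.2 ⟨ENNReal.mul_lt_top ENNReal.ofReal_lt_top (edist_lt_top _ _),
      ENNReal.mul_lt_top ENNReal.ofReal_lt_top (edist_lt_top _ _)⟩
  · have hπ : partialTransport m (fun i => (r i, x i)) (fun i => (x i, x i)) ∈
        couplings (partialTransport m r x) (empiricalMeasure x) := by
      refine ⟨isProbabilityMeasure_partialTransport hH h0 h1 _ _, ?_, ?_⟩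
      · rw [map_partialTransport _ _ _ measurable_fst]; rfl
      · rw [map_partialTransport _ _ _ measurable_snd]; exact partialTransport_self h0 h1 x
    simp only [wassersteinDist, ENNReal.rpow_one, div_one]
    refine (iInf₂_le _ hπ).trans ?_
    rw [lintegral_partialTransport _ _ _ (by fun_prop)]
    simp only [edist_self, mul_zero, add_zero, edist_dist]
    simp only [← ENNReal.ofReal_mul (h0 _)]
    rw [← ENNReal.ofReal_sum_of_nonneg fun i _ => mul_nonneg (h0 i) dist_nonneg,
      ← ENNReal.ofReal_natCast, ← ENNReal.ofReal_inv_of_pos hH',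
      ← ENNReal.ofReal_mul (by positivity)]
    apply ENNReal.ofReal_le_ofReal
    rwa [inv_mul_le_iff₀ hH']

theorem ofReal_le_partialTransport_apply {X : Type*} [MeasurableSpace X] {H : ℕ} (hH : 0 < H)
    {m : Fin H → ℝ} (h0 : ∀ i, 0 ≤ m i) {r : Fin H → X} (x : Fin H → X) {s : Set X}
    (hs : MeasurableSet s) (hr : ∀ i, r i ∈ s) :
    ENNReal.ofReal ((∑ i, m i) / H) ≤ partialTransport m r x s := by
  have hH' : (0 : ℝ) < H := by exact_mod_cast hH
  rw [← lintegral_indicator_one hs,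
    lintegral_partialTransport _ _ _ (measurable_one.indicator hs), div_eq_inv_mul,
    ENNReal.ofReal_mul (by positivity), ENNReal.ofReal_inv_of_pos hH', ENNReal.ofReal_natCast,
    ENNReal.ofReal_sum_of_nonneg fun i _ => h0 i]
  gcongr with i
  simp [hr i]

/-- Weak duality for worst-case probabilities: `l` times the indicator of `s` is bounded at the
first component of a coupling by the transport cost plus `(l - infDist · s)⁺` at the second. -/
theorem measure_le_of_mem_wassersteinBall {X : Type*} [MetricSpace X] [MeasurableSpace X]
    [BorelSpace X] [SecondCountableTopology X] {H : ℕ} (hH : 0 < H) {x : Fin H → X}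
    {θ ε l : ℝ} (hθ : 0 ≤ θ) (hl : 0 < l) {s : Set X} (hs : MeasurableSet s) {g : Fin H → ℝ} (hg : ∀ i, g i ≤ 0)
    (hd : ∀ i, ∀ z ∈ s, l + g i ≤ dist z (x i))
    (hle : θ - (1 / (H : ℝ)) * ∑ i, g i ≤ l * ε) {F : Measure X}
    (hF : F ∈ wassersteinBall (empiricalMeasure x) 1 θ) : F s ≤ ENNReal.ofReal ε := by
  rcases s.eq_empty_or_nonempty with rfl | hne
  · simp
  have hH' : (0 : ℝ) < H := by exact_mod_cast hH
  let c : X → ℝ≥0∞ := fun z => ENNReal.ofReal (l - Metric.infDist z s)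
  have hc : Measurable c := by
    have : Continuous fun z => l - Metric.infDist z s :=
      continuous_const.sub (Metric.continuous_infDist_pt s)
    exact this.measurable.ennreal_ofReal
  have hcx : ∀ i, c (x i) ≤ ENNReal.ofReal (-g i) := fun i => by
    apply ENNReal.ofReal_le_ofReal
    have : l + g i ≤ Metric.infDist (x i) s :=
      (Metric.le_infDist hne).2 fun {z} hz => by rw [dist_comm]; exact hd i z hz
    linarith
  have hmean : ∫⁻ z, c z ∂(empiricalMeasure x) ≤ ENNReal.ofReal (l * ε - θ) := by
    simp only [empiricalMeasure, lintegral_smul_measure, lintegral_finsetSum_measure,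
      lintegral_dirac' _ hc, smul_eq_mul]
    calc (H : ℝ≥0∞)⁻¹ * ∑ i, c (x i) ≤ (H : ℝ≥0∞)⁻¹ * ∑ i, ENNReal.ofReal (-g i) := by
          gcongr with i; exact hcx i
      _ = ENNReal.ofReal ((H : ℝ)⁻¹ * ∑ i, -g i) := by
          rw [ENNReal.ofReal_mul (by positivity), ENNReal.ofReal_inv_of_pos hH',
            ENNReal.ofReal_natCast, ENNReal.ofReal_sum_of_nonneg fun i _ => neg_nonneg.2 (hg i)]
      _ ≤ _ := by
          apply ENNReal.ofReal_le_ofReal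
          rw [Finset.sum_neg_distrib]
          rw [one_div] at hle
          linarith
  have hpt : ∀ w : X × X, s.indicator (fun _ => ENNReal.ofReal l) w.1 ≤ edist w.1 w.2 + c w.2 := by
    intro w
    by_cases hw : w.1 ∈ s
    · rw [Set.indicator_of_mem hw]
      have h1 : Metric.infDist w.2 s ≤ dist w.1 w.2 := by
        rw [dist_comm]; exact Metric.infDist_le_dist_of_mem hw
      rw [edist_dist]
      refine le_trans (ENNReal.ofReal_le_ofReal ?_) ENNReal.ofReal_add_le
      linarith
    · rw [Set.indicator_of_notMem hw]; exact zero_le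
  have hkey : ENNReal.ofReal l * F s - ENNReal.ofReal (l * ε - θ) ≤ ENNReal.ofReal θ := by
    refine le_trans ?_ hF.2
    simp only [wassersteinDist, ENNReal.rpow_one, div_one]
    refine le_iInf₂ fun π hπ => ?_
    rw [tsub_le_iff_right]
    calc ENNReal.ofReal l * F s
        = ∫⁻ w, s.indicator (fun _ => ENNReal.ofReal l) w.1 ∂π := by
          rw [← lintegral_map (measurable_const.indicator hs) measurable_fst, hπ.2.1,
            lintegral_indicator_const hs]
      _ ≤ ∫⁻ w, (edist w.1 w.2 + c w.2) ∂π := lintegral_mono hpt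
      _ = ∫⁻ w, edist w.1 w.2 ∂π + ∫⁻ z, c z ∂(empiricalMeasure x) := by
          rw [lintegral_add_left (by fun_prop), ← hπ.2.2, lintegral_map hc measurable_snd]
      _ ≤ _ := by gcongr
  have hnn : 0 ≤ l * ε - θ := by
    have : (1 / (H : ℝ)) * ∑ i, g i ≤ 0 :=
      mul_nonpos_of_nonneg_of_nonpos (by positivity) (Finset.sum_nonpos fun i _ => hg i)
    linarith
  rw [tsub_le_iff_right, ← ENNReal.ofReal_add hθ hnn, add_sub_cancel,
    ENNReal.ofReal_mul hl.le] at hkey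
  exact (ENNReal.mul_le_mul_iff_right (by simpa using hl) ENNReal.ofReal_ne_top).1 hkey

/-! ### Equivalence of the feasible sets -/

theorem measurableSet_inner_le {K : Type*} [Fintype K] (ρ : EuclideanSpace ℝ K) (y : ℝ)
    (s : Set (EuclideanSpace ℝ K)) :
    MeasurableSet {r : s | inner ℝ ρ (r : EuclideanSpace ℝ K) ≤ y} :=
  (isClosed_le (continuous_const.inner continuous_subtype_val) continuous_const).measurableSet

theorem mem_drccFeasible_of_mem_biconvexFeasible {K : Type*} [Fintype K]
    {Q : Set (EuclideanSpace ℝ K)} {ε θ : ℝ} (hθ : 0 ≤ θ) {H : ℕ} (hH : 0 < H)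
    {ξ : Fin H → nonnegOrthant K} {y l : ℝ} {ρ : EuclideanSpace ℝ K} {g lam : Fin H → ℝ}
    {ζ : Fin H → EuclideanSpace ℝ K}
    (hB : ((y, ρ), (l, g, lam, ζ)) ∈
      biconvexFeasible (fun i => (ξ i : EuclideanSpace ℝ K)) Q ε θ) :
    (y, ρ) ∈ drccFeasible (nonnegOrthant K) (wassersteinBall (empiricalMeasure ξ) 1 θ) Q ε := by
  obtain ⟨hle, hdual, hn, hlam, hζ, hl, hg, hρ⟩ := hB
  refine ⟨iSup₂_le fun F hF => ?_, hρ⟩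
  refine measure_le_of_mem_wassersteinBall hH hθ hl (measurableSet_inner_le ρ y _) hg
    (fun i z hz => ?_) hle hF
  rw [Subtype.dist_eq, dist_eq_norm]
  exact (hdual i).trans (dual_value_le_norm_sub (hlam i) (hζ i) (hn i) z.2 hz)

/-- The multipliers `(lam i, ζ i)` are optimal for the distance from `ξ i` to the unsafe set, and
`g i = -(l - d i)⁺` for a threshold `l` that exists because otherwise moving mass onto the
projections of the scenarios would violate the robust constraint. -/
theorem exists_mem_biconvexFeasible {K : Type*} [Fintype K]
    {Q : Set (EuclideanSpace ℝ K)} (hQ : Q ⊆ nonnegOrthant K) {ε θ : ℝ}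
    (hε : ε ∈ Set.Ioo (0 : ℝ) 1) (hθ : 0 < θ) {H : ℕ} (hH : 0 < H)
    {ξ : Fin H → nonnegOrthant K} {y : ℝ} {ρ : EuclideanSpace ℝ K}
    (hC : (y, ρ) ∈
      drccFeasible (nonnegOrthant K) (wassersteinBall (empiricalMeasure ξ) 1 θ) Q ε) :
    ∃ (l : ℝ) (g lam : Fin H → ℝ) (ζ : Fin H → EuclideanSpace ℝ K),
      ((y, ρ), (l, g, lam, ζ)) ∈
        biconvexFeasible (fun i => (ξ i : EuclideanSpace ℝ K)) Q ε θ := by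
  obtain ⟨hsup, hρQ⟩ := hC
  have hρ : ρ ∈ nonnegOrthant K := hQ hρQ
  have hH' : (0 : ℝ) < H := by exact_mod_cast hH
  rcases lt_or_ge y 0 with hy | hy
  · -- The unsafe set is empty, and the dual value `-λ y` of `(λ, λ ρ)` is unbounded.
    have hl : 0 < θ / ε := div_pos hθ hε.1
    have hlam : 0 ≤ θ / ε / -y := div_nonneg hl.le (by linarith)
    refine ⟨θ / ε, 0, fun _ => θ / ε / -y, fun _ => (θ / ε / -y) • ρ, ?_, fun i => ?_, fun i => ?_,
      fun _ => hlam, fun _ k => mul_nonneg hlam (hρ k), hl, fun _ => le_rfl, hρQ⟩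
    · simp [div_mul_cancel₀ _ hε.1.ne']
    · have : θ / ε / -y * -y = θ / ε := div_mul_cancel₀ _ (by linarith)
      rw [real_inner_smul_left, Pi.zero_apply]
      linarith
    · simp
  choose r hr hry c hc ζ hζ hn hval using fun i =>
    exists_projection_dual_value_eq hρ (ξ i).2 hy
  let r' : Fin H → nonnegOrthant K := fun i => ⟨r i, hr i⟩
  have hdist : ∀ i, dist (r' i) (ξ i) = ‖r i - ξ i‖ := fun i => by
    rw [Subtype.dist_eq, dist_eq_norm]
  obtain ⟨l, hl, hlb⟩ : ∃ l : ℝ, 0 ≤ l ∧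
      H * θ + ∑ i, max (l - dist (r' i) (ξ i)) 0 ≤ l * (ε * H) := by
    by_contra! hcon
    obtain ⟨m, h0, h1, hcost, hmass⟩ := exists_fractional_selection
      (fun i => dist_nonneg (x := r' i) (y := ξ i)) (mul_nonneg hε.1.le hH'.le)
      (by rw [Fintype.card_fin]; exact mul_lt_of_lt_one_left hH' hε.2) hcon
    have h2 := (ofReal_le_partialTransport_apply hH h0 ξ (measurableSet_inner_le ρ y _)
      (r := r') hry).trans <| (le_iSup₂
        (f := fun F (_ : F ∈ wassersteinBall (empiricalMeasure ξ) 1 θ) =>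
          F {r : nonnegOrthant K | inner ℝ ρ (r : EuclideanSpace ℝ K) ≤ y}) _
        (partialTransport_mem_wassersteinBall hH h0 h1 r' ξ hcost)).trans hsup
    rw [ENNReal.ofReal_le_ofReal_iff hε.1.le, div_le_iff₀ hH'] at h2
    exact hmass.not_ge h2
  have hlpos : 0 < l := by
    refine hl.lt_of_ne' ?_
    rintro rfl
    have : 0 ≤ ∑ i, max (0 - dist (r' i) (ξ i)) 0 :=
      Finset.sum_nonneg fun i _ => le_max_right _ _
    have := mul_pos hH' hθ
    linarith
  refine ⟨l, fun i => -max (l - dist (r' i) (ξ i)) 0, c, ζ, ?_, fun i => ?_, hn, hc, hζ, hlpos,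
    fun i => neg_nonpos.2 (le_max_right _ _), hρQ⟩
  · rw [Finset.sum_neg_distrib, mul_neg, sub_neg_eq_add, ← mul_le_mul_iff_right₀ hH', mul_add,
      ← mul_assoc, mul_one_div_cancel hH'.ne', one_mul]
    linarith
  · rw [hval i, ← hdist i]
    have := le_max_left (l - dist (r' i) (ξ i)) 0
    linarith

/-! ### Optimal values and biconvexity -/

theorem optimalValue_image {X Y : Type*} (f : X → Y) (B : Set X) (u : Y → ℝ) :
    optimalValue (f '' B) u = optimalValue B fun x => u (f x) :=
  iSup_image

theorem optimalSolutions_image {X Y : Type*} (f : X → Y) (B : Set X) (u : Y → ℝ) :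
    optimalSolutions (f '' B) u = f '' optimalSolutions B fun x => u (f x) := by
  ext y
  constructor
  · rintro ⟨⟨x, hx, rfl⟩, h⟩
    exact ⟨x, ⟨hx, fun x' hx' => h _ ⟨x', hx', rfl⟩⟩, rfl⟩
  · rintro ⟨x, ⟨hx, h⟩, rfl⟩
    refine ⟨⟨x, hx, rfl⟩, ?_⟩
    rintro _ ⟨x', hx', rfl⟩
    exact h x' hx'

theorem convex_occupationPolytope {S : Type*} {A : S → Type*} [Fintype S] [DecidableEq S]
    [∀ s, Fintype (A s)] (p : (Σ s, A s) → S → ℝ) (γ : S → ℝ) (α : ℝ) :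
    Convex ℝ (occupationPolytope p γ α) := by
  rintro ρ ⟨h1, h2⟩ σ ⟨h3, h4⟩ a b ha hb hab
  refine ⟨fun s => ?_, fun k => add_nonneg (mul_nonneg ha (h2 k)) (mul_nonneg hb (h4 k))⟩
  simp only [PiLp.add_apply, PiLp.smul_apply, smul_eq_mul, add_mul, mul_assoc,
    Finset.sum_add_distrib, ← Finset.mul_sum, h1, h3]
  rw [← add_mul, hab, one_mul]

theorem convex_nonnegOrthant (K : Type*) : Convex ℝ (nonnegOrthant K) :=
  fun _ hx _ hz _ _ ha hb _ k => add_nonneg (mul_nonneg ha (hx k)) (mul_nonneg hb (hz k))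

theorem isBiconvexProgram_biconvexFeasible {K : Type*} [Fintype K] {H : ℕ}
    (ξ : Fin H → EuclideanSpace ℝ K) {Q : Set (EuclideanSpace ℝ K)} (hQ : Convex ℝ Q) (ε θ : ℝ) :
    IsBiconvexProgram (biconvexFeasible ξ Q ε θ) fun w => w.1.1 := by
  have hball : Convex ℝ {v : EuclideanSpace ℝ K | ‖v‖ ≤ 1} := by
    simpa [Metric.closedBall] using convex_closedBall (0 : EuclideanSpace ℝ K) 1
  constructor
  · rintro ⟨y, ρ⟩
    refine concaveOn_const _ ?_
    rintro ⟨l, g, lam, ζ⟩ ⟨h1, h2, h3, h4, h5, h6, h7, h8⟩ ⟨l', g', lam', ζ'⟩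
      ⟨k1, k2, k3, k4, k5, k6, k7, -⟩ a b ha hb hab
    refine ⟨?_, fun i => ?_, fun i => ?_, fun i => ?_, fun i => ?_, ?_, fun i => ?_, h8⟩
    · have := add_le_add (mul_le_mul_of_nonneg_left h1 ha) (mul_le_mul_of_nonneg_left k1 hb)
      simp only [Prod.smul_mk, Pi.add_apply, Pi.smul_apply, smul_eq_mul, Finset.sum_add_distrib,
        ← Finset.mul_sum]
      linear_combination this - θ * hab
    · have := add_le_add (mul_le_mul_of_nonneg_left (h2 i) ha) (mul_le_mul_of_nonneg_left (k2 i) hb)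
      simp only [Prod.smul_mk, Pi.add_apply, Pi.smul_apply, smul_eq_mul, inner_add_left,
        real_inner_smul_left]
      linear_combination this
    · have h := hball (h3 i) (k3 i) ha hb hab
      rw [Set.mem_ofPred_eq] at h
      convert h using 2
      simp only [Prod.smul_mk, Pi.add_apply, Pi.smul_apply, smul_eq_mul]
      module
    · exact add_nonneg (mul_nonneg ha (h4 i)) (mul_nonneg hb (k4 i))
    · exact convex_nonnegOrthant K (h5 i) (k5 i) ha hb hab
    · exact convex_Ioi (𝕜 := ℝ) (0 : ℝ) h6 k6 ha hb hab
    · exact convex_Iic (𝕜 := ℝ) (0 : ℝ) (h7 i) (k7 i) ha hb hab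
  · rintro ⟨l, g, lam, ζ⟩
    refine LinearMap.concaveOn (LinearMap.fst ℝ ℝ (EuclideanSpace ℝ K)) ?_
    rintro ⟨y, ρ⟩ ⟨h1, h2, h3, h4, h5, h6, h7, h8⟩ ⟨y', ρ'⟩ ⟨-, k2, k3, -, -, -, -, k8⟩ a b ha hb hab
    refine ⟨h1, fun i => ?_, fun i => ?_, h4, h5, h6, h7, hQ h8 k8 ha hb hab⟩
    · have := add_le_add (mul_le_mul_of_nonneg_left (h2 i) ha) (mul_le_mul_of_nonneg_left (k2 i) hb)
      simp only [Prod.smul_mk, smul_eq_mul, inner_add_left, real_inner_smul_left]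
      linear_combination this - (l + g i + inner ℝ (ζ i) (ξ i)) * hab
    · have h := hball (h3 i) (k3 i) ha hb hab
      rw [Set.mem_ofPred_eq] at h
      convert h using 2
      rw [smul_sub, smul_sub, sub_add_sub_comm, ← add_smul, hab, one_smul]
      simp only [Prod.smul_mk, smul_add, smul_comm (lam i)]

theorem theorem4p3 {S : Type*} {A : S → Type*} [Fintype S] [DecidableEq S]
    [∀ s, Fintype (A s)]
    (p : (Σ s, A s) → S → ℝ) (hp : ∀ k, p k ∈ stdSimplex ℝ S)
    (γ : S → ℝ) (hγ : γ ∈ stdSimplex ℝ S)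
    (α : ℝ) (hα : α ∈ Set.Ioo (0 : ℝ) 1)
    (ε : ℝ) (hε : ε ∈ Set.Ioo (0 : ℝ) 1)
    (θ : ℝ) (hθ : 0 < θ)
    (H : ℕ) (hH : 0 < H) (ξ : Fin H → nonnegOrthant (Σ s, A s)) :
    -- the two feasible sets, the robust one and that of the reformulation
    let C := drccFeasible (nonnegOrthant (Σ s, A s))
      (wassersteinBall (empiricalMeasure ξ) 1 θ) (occupationPolytope p γ α) ε
    let B := biconvexFeasible (fun i => (ξ i : EuclideanSpace ℝ (Σ s, A s)))
      (occupationPolytope p γ α) ε θ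
    -- `(y, ρ)` is feasible iff it extends to a feasible point of the reformulation
    (∀ (y : ℝ) (ρ : EuclideanSpace ℝ (Σ s, A s)),
      (y, ρ) ∈ C ↔ ∃ (l : ℝ) (g lam : Fin H → ℝ) (ζ : Fin H → EuclideanSpace ℝ (Σ s, A s)),
        ((y, ρ), (l, g, lam, ζ)) ∈ B) ∧
    -- equal optimal values, and corresponding optimal solutions
    optimalValue C (fun x => x.1) = optimalValue B (fun w => w.1.1) ∧
    optimalSolutions C (fun x => x.1) = Prod.fst '' optimalSolutions B (fun w => w.1.1) ∧
    -- the reformulation is biconvex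
    IsBiconvexProgram B (fun w => w.1.1) := by
  intro C B
  have hiff : ∀ (y : ℝ) (ρ : EuclideanSpace ℝ (Σ s, A s)),
      (y, ρ) ∈ C ↔ ∃ (l : ℝ) (g lam : Fin H → ℝ) (ζ : Fin H → EuclideanSpace ℝ (Σ s, A s)),
        ((y, ρ), (l, g, lam, ζ)) ∈ B := fun y ρ =>
    ⟨exists_mem_biconvexFeasible (fun _ h => h.2) hε hθ hH,
      fun ⟨_, _, _, _, h⟩ => mem_drccFeasible_of_mem_biconvexFeasible hθ.le hH h⟩
  have hCB : C = Prod.fst '' B := by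
    ext ⟨y, ρ⟩
    rw [hiff]
    constructor
    · rintro ⟨l, g, lam, ζ, h⟩
      exact ⟨_, h, rfl⟩
    · rintro ⟨⟨_, l, g, lam, ζ⟩, h, rfl⟩
      exact ⟨l, g, lam, ζ, h⟩
  refine ⟨hiff, ?_, ?_, isBiconvexProgram_biconvexFeasible _ (convex_occupationPolytope p γ α) ε θ⟩
  · rw [hCB]
    exact optimalValue_image Prod.fst B fun x => x.1
  · rw [hCB]
    exact optimalSolutions_image Prod.fst B fun x => x.1
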